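/- A fair coin is flipped $n\ge 0$ times. Alice gets a point for each $HH$ and Bob gets a point for each $HT$ (two consecutive flips) in the resulting sequence. Let $\Delta_n$ be the probability that Bob has more points than Alice minus the probability that Alice has more points than Bob, let $d_n=2^n\Delta_n+\tfrac12$, and let $\tilde f(t)=\sum_{n\ge 0}d_nt^n$. Then: 1. As a formal power series, $\tilde f$ satisfies $$(4t^4-4t^3+t^2-2t+1)\,\tilde f'(t)+(8t^3-6t^2+t-1)\,\tilde f(t)=0 .$$ Moreover the series converges for every real $t$ with $|t|<\tfrac12$, its sum is differentiable there, and the same equation holds there for the sum. 2. For every $n\ge 4$, $$\Bigl(-\tfrac 8n+4\Bigr)d_{n-4}-\Bigl(-\tfrac 6n+4\Bigr)d_{n-3}+\Bigl(-\tfrac 1n+1\Bigr)d_{n-2}-\Bigl(-\tfrac 1n+2\Bigr)d_{n-1}+d_n=0 .$$ 3. For every $n\ge 4$, $$\Delta_n=\frac1{n2^n}+\Bigl(\frac1{2n}-\frac14\Bigr)\Delta_{n-4}+\Bigl(-\frac3{4n}+\frac12\Bigr)\Delta_{n-3}+\Bigl(\frac1{4n}-\frac14\Bigr)\Delta_{n-2}+\Bigl(-\frac1{2n}+1\Bigr)\Delta_{n-1}.$$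 4. The whole sequence $\Delta_1,\dots,\Delta_n$ can be computed in $O(n)$ time, where time counts executed instructions, each (including each arithmetic operation on rational numbers) at unit cost: there are a single program for a register machine with rational registers (instructions: loading an integer constant, $+$, $-$, $\times$, $\div$, jump, jump if positive, write to the output, halt; no indirect addressing) and a constant $C$ such that, for every $n\ge1$, the program started with $n$ in its input register halts after at most $Cn$ steps, having output exactly the list $\Delta_1,\dots,\Delta_n$. -/

import Mathlib

namespace CoinGame

/-- `n` flips of a coin; `true` is heads (`H`) and `false` is tails (`T`). -/
abbrev Flips (n : ℕ) : Type := Fin n → Bool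

/-- The number of places of `ω` where a flip `a` is immediately followed by a flip `b`. -/
def occurrences {n : ℕ} (a b : Bool) (ω : Flips n) : ℕ :=
  (Finset.univ.filter fun p : Fin n × Fin n =>
    (p.2 : ℕ) = (p.1 : ℕ) + 1 ∧ ω p.1 = a ∧ ω p.2 = b).card

/-- Alice gets a point for each `HH`. -/
def aliceScore {n : ℕ} (ω : Flips n) : ℕ := occurrences true true ω

/-- Bob gets a point for each `HT`. -/
def bobScore {n : ℕ} (ω : Flips n) : ℕ := occurrences true false ω

/-- The probability that `n` flips of a fair coin (uniform on the `2 ^ n` outcomes) satisfy `E`. -/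
def prob (n : ℕ) (E : Flips n → Prop) [DecidablePred E] : ℚ :=
  ((Finset.univ.filter E).card : ℚ) / 2 ^ n

/-- `Δ_n`: the probability that Bob has more points after `n` flips, minus the probability that
Alice has more points. -/
def delta (n : ℕ) : ℚ :=
  prob n (fun ω => aliceScore ω < bobScore ω) - prob n (fun ω => bobScore ω < aliceScore ω)

/-- `d_n = 2 ^ n Δ_n + 1 / 2`. -/
def d (n : ℕ) : ℚ := 2 ^ n * delta n + 1 / 2

/-- The generating function of `d_n`, as a formal power series. -/
def dSeries : PowerSeries ℚ := PowerSeries.mk d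

/-- The generating function of `d_n`, as a function of a real variable. -/
noncomputable def dFun (t : ℝ) : ℝ := ∑' n : ℕ, (d n : ℝ) * t ^ n

/-! ### A register machine with unit-cost rational arithmetic

Registers are indexed by `ℕ` and hold rational numbers. A program is a fixed finite list of
instructions, so it names only finitely many registers and constants, and there is no indirect
addressing: this is a restricted form of the arithmetic random access machine. Every executed
instruction costs one time unit. -/

/-- The instructions. Here `r`, `a`, `b` are register numbers and `l` is a program line. -/
inductive Instr : Type
  /-- `r := k` -/
  | const (r : ℕ) (k : ℤ)
  /-- `r := a + b` -/
  | add (r a b : ℕ)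
  /-- `r := a - b` -/
  | sub (r a b : ℕ)
  /-- `r := a * b` -/
  | mul (r a b : ℕ)
  /-- `r := a / b`; the machine crashes if register `b` holds `0` -/
  | div (r a b : ℕ)
  /-- continue at line `l` -/
  | jump (l : ℕ)
  /-- continue at line `l` if register `a` holds a positive number -/
  | jumpPos (a l : ℕ)
  /-- append the content of register `a` to the output -/
  | write (a : ℕ)
  /-- stop -/
  | halt

/-- A configuration: current line, contents of the registers, output written so far. -/
structure Config : Type where
  line : ℕ
  reg : ℕ → ℚ
  out : List ℚ

/-- Go to the next line after setting register `r` to `x`. -/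
def Config.set (c : Config) (r : ℕ) (x : ℚ) : Config :=
  ⟨c.line + 1, Function.update c.reg r x, c.out⟩

/-- Execution of one instruction; `none` if there is no next configuration (the machine has
halted, has divided by zero, or has left the program). -/
def step (P : List Instr) (c : Config) : Option Config :=
  match P[c.line]? with
  | none => none
  | some (.const r k) => some (c.set r k)
  | some (.add r a b) => some (c.set r (c.reg a + c.reg b))
  | some (.sub r a b) => some (c.set r (c.reg a - c.reg b))
  | some (.mul r a b) => some (c.set r (c.reg a * c.reg b))
  | some (.div r a b) => if c.reg b = 0 then none else some (c.set r (c.reg a / c.reg b))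
  | some (.jump l) => some ⟨l, c.reg, c.out⟩
  | some (.jumpPos a l) => some ⟨if 0 < c.reg a then l else c.line + 1, c.reg, c.out⟩
  | some (.write a) => some ⟨c.line + 1, c.reg, c.out ++ [c.reg a]⟩
  | some .halt => none

/-- `P` leads from the first configuration to the second in exactly the given number of steps. -/
def Reaches (P : List Instr) : ℕ → Config → Config → Prop
  | 0, c, c' => c = c'
  | t + 1, c, c' => ∃ c₁, step P c = some c₁ ∧ Reaches P t c₁ c'

/-- The start on input `n`: register `0` holds `n`, all others hold `0`, nothing is written. -/
def start (n : ℕ) : Config := ⟨0, fun r => if r = 0 then (n : ℚ) else 0, []⟩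

/-- On input `n` the program `P` arrives at a `halt` instruction after exactly `t` steps, having
written exactly the list `out`. -/
def OutputsInTime (P : List Instr) (n : ℕ) (out : List ℚ) (t : ℕ) : Prop :=
  ∃ c, Reaches P t (start n) c ∧ P[c.line]? = some Instr.halt ∧ c.out = out

end CoinGame

namespace CoinGame

/-! Only the sign of Bob's lead matters, and the lead with the last flip is a Markov chain. So `2 ^
n * delta n` is the tally `signTally n false 0`, and the generating functions of the tallies satisfy
linear one-step equations, which determine them. A first-passage ansatz solves these equations: with
`i = 1 / (1 - X)` and `w = i + X ^ 3 * w ^ 2`, it gives `2 * dSeries = i / (1 - 2 * X ^ 3 * w)`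
(`exists_two_mul_dSeries_eq`). Eliminating `w` yields `R * (2 * dSeries) ^ 2 = 1` with `R` the
quartic (`quartic_mul_dSeries_sq`).

Differentiating this gives the differential equation, and its coefficients give both recurrences.
The bound `|d n| ≤ 2 * 2 ^ n` carries the equation over to the real function. The recurrence has
bounded length, so a program does constant work per term. -/

/-! ### Scores under prepending a flip -/

theorem occurrences_cons {n : ℕ} (a b x : Bool) (ω : Flips n) :
    occurrences a b (Fin.cons x ω : Flips (n + 1)) =
      (∑ i : Fin n, if (i : ℕ) = 0 ∧ x = a ∧ ω i = b then 1 else 0) + occurrences a b ω := by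
  unfold occurrences
  rw [Finset.card_filter, Finset.card_filter, Fintype.sum_prod_type, Fintype.sum_prod_type,
    Fin.sum_univ_succ]
  congr 1
  · rw [Fin.sum_univ_succ]
    simp
  · refine Finset.sum_congr rfl fun i _ => ?_
    rw [Fin.sum_univ_succ]
    simp

theorem occurrences_cons_of_ne {n : ℕ} {a b x : Bool} (h : x ≠ a) (ω : Flips n) :
    occurrences a b (Fin.cons x ω : Flips (n + 1)) = occurrences a b ω := by
  simp [occurrences_cons, h]

theorem occurrences_cons_cons {n : ℕ} (a b x y : Bool) (ω : Flips n) :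
    occurrences a b (Fin.cons x (Fin.cons y ω : Flips (n + 1)) : Flips (n + 2)) =
      (if x = a ∧ y = b then 1 else 0) + occurrences a b (Fin.cons y ω : Flips (n + 1)) := by
  rw [occurrences_cons, Fin.sum_univ_succ]
  simp

/-- Bob's lead over Alice. -/
def lead {n : ℕ} (ω : Flips n) : ℤ := (bobScore ω : ℤ) - aliceScore ω

theorem lead_cons_false {n : ℕ} (ω : Flips n) : lead (Fin.cons false ω : Flips (n + 1)) = lead ω := by
  simp [lead, bobScore, aliceScore, occurrences_cons_of_ne]

theorem lead_cons_true_true {n : ℕ} (ω : Flips n) :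
    lead (Fin.cons true (Fin.cons true ω : Flips (n + 1)) : Flips (n + 2)) =
      lead (Fin.cons true ω : Flips (n + 1)) - 1 := by
  simp [lead, bobScore, aliceScore, occurrences_cons_cons]
  ring

theorem lead_cons_true_false {n : ℕ} (ω : Flips n) :
    lead (Fin.cons true (Fin.cons false ω : Flips (n + 1)) : Flips (n + 2)) =
      lead (Fin.cons false ω : Flips (n + 1)) + 1 := by
  simp [lead, bobScore, aliceScore, occurrences_cons_cons]
  ring

/-! ### Sign tallies -/

/-- The sum, over all continuations by `n` flips after a flip `c`, of the sign of Bob's final lead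
when he starts with the lead `k`. -/
def signTally : ℕ → Bool → ℤ → ℚ
  | 0, _, k => k.sign
  | n + 1, false, k => signTally n false k + signTally n true k
  | n + 1, true, k => signTally n true (k - 1) + signTally n false (k + 1)

theorem sum_flips_succ {n : ℕ} (f : Flips (n + 1) → ℚ) :
    ∑ ω, f ω = ∑ ω : Flips n, f (Fin.cons false ω) + ∑ ω : Flips n, f (Fin.cons true ω) := by
  rw [← (Fin.consEquiv fun _ : Fin (n + 1) => Bool).sum_comp, Fintype.sum_prod_type,
    Fintype.sum_bool, add_comm]
  rfl

theorem signTally_eq_sum (n : ℕ) (c : Bool) (k : ℤ) :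
    signTally n c k =
      ∑ ω : Flips n, ((k + lead (Fin.cons c ω : Flips (n + 1))).sign : ℚ) := by
  induction n generalizing c k with
  | zero =>
    cases c <;>
      simp [signTally, lead, bobScore, aliceScore, occurrences]
  | succ n ih =>
    cases c with
    | false =>
      simp only [signTally, ih, sum_flips_succ, lead_cons_false]
    | true =>
      simp only [signTally, ih, sum_flips_succ, lead_cons_true_true, lead_cons_true_false]
      rw [add_comm]
      congr! 4 <;> ring_nf

/-- A fictitious tail before the first flip scores for nobody, so the game starts in the state
"after `T`, lead `0`". -/
theorem two_pow_mul_delta (n : ℕ) : 2 ^ n * delta n = signTally n false 0 := by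
  rw [signTally_eq_sum]
  unfold delta prob
  rw [← sub_div, mul_div_cancel₀ _ (by positivity), Finset.natCast_card_filter,
    Finset.natCast_card_filter, ← Finset.sum_sub_distrib]
  refine Finset.sum_congr rfl fun ω _ => ?_
  rw [lead_cons_false, zero_add, lead]
  rcases lt_trichotomy (aliceScore ω) (bobScore ω) with h | h | h
  · rw [Int.sign_eq_one_of_pos (by omega)]
    simp [h, h.le]
  · simp [h]
  · rw [Int.sign_eq_neg_one_of_neg (by omega)]
    simp [h, h.le]

theorem abs_signTally_le (n : ℕ) (c : Bool) (k : ℤ) : |signTally n c k| ≤ 2 ^ n := by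
  induction n generalizing c k with
  | zero =>
    rcases lt_trichotomy k 0 with h | h | h
    · simp [signTally, Int.sign_eq_neg_one_of_neg h]
    · simp [signTally, h]
    · simp [signTally, Int.sign_eq_one_of_pos h]
  | succ n ih =>
    cases c <;>
    · refine (abs_add_le _ _).trans ?_
      rw [pow_succ, mul_two]
      exact add_le_add (ih _ _) (ih _ _)

theorem abs_d_le (n : ℕ) : |d n| ≤ 2 * 2 ^ n := by
  have h := abs_signTally_le n false 0
  have h1 : (1 : ℚ) ≤ 2 ^ n := one_le_pow₀ (by norm_num)
  rw [d, two_pow_mul_delta]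
  refine (abs_add_le _ _).trans ?_
  rw [abs_of_pos (by norm_num : (0 : ℚ) < 1 / 2)]
  linarith

/-! ### Generating functions and the closed form -/

section

open PowerSeries

/-- A family of power series satisfying the one-step equations has the tallies as coefficients. -/
theorem coeff_eq_signTally {F : Bool → ℤ → PowerSeries ℚ}
    (hT : ∀ k, F false k = (k.sign : PowerSeries ℚ) + X * (F false k + F true k))
    (hH : ∀ k, F true k = (k.sign : PowerSeries ℚ) + X * (F true (k - 1) + F false (k + 1)))
    (n : ℕ) (c : Bool) (k : ℤ) : coeff n (F c k) = signTally n c k := by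
  have hs : ∀ m : ℤ, (m : PowerSeries ℚ) = C (m : ℚ) := fun m => (map_intCast (C (R := ℚ)) m).symm
  induction n generalizing c k with
  | zero =>
    cases c
    · rw [hT]; simp [signTally]
    · rw [hH]; simp [signTally]
  | succ n ih =>
    cases c
    · rw [hT, hs, map_add, coeff_succ_X_mul, coeff_succ_C, map_add, ih, ih, zero_add, signTally]
    · rw [hH, hs, map_add, coeff_succ_X_mul, coeff_succ_C, map_add, ih, ih, zero_add, signTally]

theorem exists_mul_eq_one {φ : PowerSeries ℚ} (h : constantCoeff φ = 1) : ∃ ψ, φ * ψ = 1 :=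
  ⟨φ⁻¹, PowerSeries.mul_inv_cancel φ (by simp [h])⟩

/-- The quadratic equation of the kernel has a root, obtained from the Catalan series. -/
theorem exists_kernel_root (φ : PowerSeries ℚ) :
    ∃ w : PowerSeries ℚ, w = φ + X ^ 3 * w ^ 2 := by
  have ha : HasSubst (X ^ 3 * φ : PowerSeries ℚ) :=
    HasSubst.of_constantCoeff_zero' (by simp)
  have h := congrArg (fun f : PowerSeries ℕ => (f.map (Nat.castRingHom ℚ)).subst
    (X ^ 3 * φ : PowerSeries ℚ)) catalanSeries_sq_mul_X_add_one
  simp only [map_add, map_mul, map_pow, map_one, PowerSeries.map_X] at h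
  rw [← coe_substAlgHom ha] at h
  simp only [map_add, map_mul, map_pow, map_one, substAlgHom_X] at h
  refine ⟨φ * substAlgHom ha (map (Nat.castRingHom ℚ) catalanSeries), ?_⟩
  -- The Catalan series `c = 1 + z * c ^ 2` at `z = X ^ 3 * φ` gives `w = φ * c`.
  linear_combination -φ * h

/-- The generating function in closed form: `i` is `1 / (1 - X)`, `w` the root of the kernel, and
`Z` is `1 / (1 - 2 X ^ 3 w)`. -/
theorem exists_two_mul_dSeries_eq : ∃ i w Z : PowerSeries ℚ,
    (1 - X) * i = 1 ∧ w = i + X ^ 3 * w ^ 2 ∧ (1 - 2 * X ^ 3 * w) * Z = 1 ∧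
      2 * dSeries = i * Z := by
  obtain ⟨i, hi'⟩ : ∃ i : PowerSeries ℚ, i = mk 1 := ⟨_, rfl⟩
  have hi : (1 - X) * i = 1 := by
    rw [hi', mul_comm]
    exact mk_one_mul_one_sub_eq_one ℚ
  obtain ⟨e, he⟩ := exists_mul_eq_one (φ := 1 - 2 * X) (by simp)
  obtain ⟨w, hw⟩ := exists_kernel_root i
  obtain ⟨Z, hZ⟩ := exists_mul_eq_one (φ := 1 - 2 * X ^ 3 * w) (by simp)
  refine ⟨i, w, Z, hi, hw, hZ, ?_⟩
  -- `h` is `e - F true 0`, solved from the equation at lead `0` after `H`; `i * G` is `e + F false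
  -- 0`.
  obtain ⟨h, hh⟩ : ∃ h, h = e - X ^ 2 * w * Z := ⟨_, rfl⟩
  obtain ⟨G, hG⟩ : ∃ G, G = e - X * h := ⟨_, rfl⟩
  -- First-passage series: `u` lowers the lead by one from `H` to `H`, `v` raises it by one from `T`
  -- to `T`.
  obtain ⟨u, hu⟩ : ∃ u, u = (1 - X) * X * w := ⟨_, rfl⟩
  obtain ⟨v, hv⟩ : ∃ v, v = X ^ 2 * w := ⟨_, rfl⟩
  have hu2 : u = X * (1 + X * i * u ^ 2) := by
    rw [hu]
    linear_combination X * (1 - X) * hw + X * hi - X ^ 4 * (1 - X) * w ^ 2 * hi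
  -- Until the lead reaches `0` its sign is constant, contributing `e` or `-e`; the correction is
  -- the passage series times the deviation at lead `0`. `X * i` passes from `T` to `H`, and `X * w
  -- = i * u` raises the lead by one from `H` to `T`, up to the factor `i` of `i * G`.
  let F : Bool → ℤ → PowerSeries ℚ := fun c k => match c, k with
    | true, .ofNat k => e - h * u ^ k
    | true, .negSucc m => -e + G * X * w * v ^ m
    | false, .ofNat 0 => -e + i * G
    | false, .ofNat (k + 1) => e - X * i * h * u ^ (k + 1)
    | false, .negSucc m => -e + i * G * v ^ (m + 1)
  have hpos : ∀ k : ℕ, (Int.ofNat (k + 1)).sign = 1 := fun _ => rfl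
  have hneg : ∀ k : ℕ, (Int.negSucc k).sign = -1 := fun _ => rfl
  have hT : ∀ k, F false k = (k.sign : PowerSeries ℚ) + X * (F false k + F true k) := by
    rintro ((_ | k) | m)
    · simp only [F, Int.ofNat_eq_natCast, Nat.cast_zero, Int.sign_zero, Int.cast_zero]
      linear_combination i * (1 - X) * hG + (e - X * h) * hi
    · simp only [F, hpos, Int.cast_one]
      linear_combination he - X * h * u ^ (k + 1) * hi
    · simp only [F, hneg, Int.cast_neg, Int.cast_one]
      linear_combination -he + G * v ^ (m + 1) * hi + G * v ^ m * hv
  have hH : ∀ k, F true k = (k.sign : PowerSeries ℚ) + X * (F true (k - 1) + F false (k + 1)) := by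
    rintro ((_ | k) | (_ | m))
    · rw [show Int.ofNat 0 - 1 = Int.negSucc 0 from rfl, show Int.ofNat 0 + 1 = Int.ofNat 1 from rfl]
      simp only [F, Int.ofNat_eq_natCast, Nat.cast_zero, Int.sign_zero, Int.cast_zero]
      linear_combination -X ^ 2 * w * hG + X ^ 2 * i * h * hu + X ^ 3 * w * h * hi
        - (1 - 2 * X ^ 3 * w) * hh + X ^ 2 * w * hZ - X ^ 2 * w * he
    · rw [show Int.ofNat (k + 1) - 1 = Int.ofNat k by simp,
        show Int.ofNat (k + 1) + 1 = Int.ofNat (k + 2) from rfl]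
      simp only [F, hpos, Int.cast_one]
      linear_combination he - h * u ^ k * hu2
    · rw [show Int.negSucc 0 - 1 = Int.negSucc 1 from rfl,
        show Int.negSucc 0 + 1 = Int.ofNat 0 from rfl]
      simp only [F, hneg, Int.cast_neg, Int.cast_one]
      linear_combination -he + G * X * hw - G * X ^ 2 * w * hv
    · rw [show Int.negSucc (m + 1) - 1 = Int.negSucc (m + 2) from rfl,
        show Int.negSucc (m + 1) + 1 = Int.negSucc m from rfl]
      simp only [F, hneg, Int.cast_neg, Int.cast_one]
      linear_combination -he + G * v ^ (m + 1) * (X * hw - X ^ 2 * w * hv)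
  have hd : 2 * dSeries = 2 * (-e + i * G) + i := by
    have hF : F false 0 = -e + i * G := rfl
    rw [← hF, two_mul, two_mul]
    ext n
    simp only [dSeries, map_add, coeff_mk, coeff_eq_signTally hT hH, d, two_pow_mul_delta, hi',
      Pi.one_apply]
    ring
  linear_combination hd + 2 * i * hG - 2 * i * X * hh + 2 * e * hi - i * hZ

/-- Completing the square in the equation of `w` gives `(1 - 2 * X ^ 3 * w) ^ 2 = 1 - 4 * X ^ 3 *
i`, which is free of `w`. -/
theorem quartic_mul_dSeries_sq :
    (4 * X ^ 4 - 4 * X ^ 3 + X ^ 2 - 2 * X + 1) * (2 * dSeries) ^ 2 = 1 := by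
  obtain ⟨i, w, Z, hi, hw, hZ, h⟩ := exists_two_mul_dSeries_eq
  have hR : (1 - X) ^ 2 * (1 - 2 * X ^ 3 * w) ^ 2 =
      4 * X ^ 4 - 4 * X ^ 3 + X ^ 2 - 2 * X + 1 := by
    linear_combination -4 * (1 - X) ^ 2 * X ^ 3 * hw - 4 * (1 - X) * X ^ 3 * hi
  rw [h, ← hR]
  calc (1 - X) ^ 2 * (1 - 2 * X ^ 3 * w) ^ 2 * (i * Z) ^ 2
      = (((1 - X) * i) * ((1 - 2 * X ^ 3 * w) * Z)) ^ 2 := by ring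
    _ = 1 := by rw [hi, hZ]; norm_num

/-- Differentiating `R * (2 * dSeries) ^ 2 = 1` leaves the equation times `8 * dSeries`, which
cancels in the domain of power series. -/
theorem dSeries_differential_equation :
    (4 * X ^ 4 - 4 * X ^ 3 + X ^ 2 - 2 * X + 1) * derivative ℚ dSeries
      + (8 * X ^ 3 - 6 * X ^ 2 + X - 1) * dSeries = 0 := by
  have h := quartic_mul_dSeries_sq
  have h0 : dSeries ≠ 0 := by
    rintro h0
    simp [h0] at h
  have hn : ∀ m : ℕ, derivative ℚ (m : PowerSeries ℚ) = 0 := fun m => Derivation.map_natCast _ m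
  have hq : ∀ q : ℕ, [q.AtLeastTwo] → derivative ℚ (OfNat.ofNat q : PowerSeries ℚ) = 0 :=
    fun q _ => hn q
  have h' := congrArg (derivative ℚ) h
  simp only [Derivation.leibniz, Derivation.leibniz_pow, map_add, map_sub, hq, derivative_X,
    Derivation.map_one_eq_zero, smul_eq_mul, nsmul_eq_mul] at h'
  have h8 : (8 * dSeries) ≠ 0 := mul_ne_zero (by
    rw [← map_ofNat (C (R := ℚ)) 8, Ne, map_eq_zero_iff _ C_injective]
    norm_num) h0
  refine (mul_eq_zero.mp ?_).resolve_left h8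
  push_cast at h'
  linear_combination h'

/-! ### Recurrences from coefficients -/

/-- The value of the sequence `d`, extended by `0`, at `n - j`. -/
def dShift (j n : ℕ) : ℚ := if j ≤ n then d (n - j) else 0

theorem coeff_X_pow_mul_dSeries (j n : ℕ) : coeff n (X ^ j * dSeries) = dShift j n := by
  rw [coeff_X_pow_mul', dShift]
  simp [dSeries]

theorem coeff_X_pow_mul_derivative_dSeries (j n : ℕ) :
    coeff n (X ^ j * derivative ℚ dSeries) = ((n : ℚ) + 1 - j) * dShift j (n + 1) := by
  rw [coeff_X_pow_mul', dShift]
  by_cases h : j ≤ n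
  · rw [if_pos h, if_pos (by omega), coeff_derivative, dSeries, coeff_mk,
      show n + 1 - j = n - j + 1 by omega, Nat.cast_sub h]
    ring
  · rw [if_neg h]
    split_ifs with h1
    · obtain rfl : j = n + 1 := by omega
      simp
    · simp

/-- Extension by `0` makes the recurrence valid from the first term on, so the program needs only `d
0` as initial value. -/
theorem d_succ_recurrence (n : ℕ) :
    ((n : ℚ) + 1) * d (n + 1) = (2 * n + 1) * dShift 1 (n + 1) - n * dShift 2 (n + 1)
      + (4 * n - 2) * dShift 3 (n + 1) - (4 * n - 4) * dShift 4 (n + 1) := by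
  have hs : ∀ j, dShift (j + 1) (n + 1) = dShift j n := by simp [dShift]
  have h := congrArg (coeff n) dSeries_differential_equation
  rw [show (4 * X ^ 4 - 4 * X ^ 3 + X ^ 2 - 2 * X + 1) * derivative ℚ dSeries
      + (8 * X ^ 3 - 6 * X ^ 2 + X - 1) * dSeries =
      (4 : ℚ) • (X ^ 4 * derivative ℚ dSeries) - (4 : ℚ) • (X ^ 3 * derivative ℚ dSeries)
      + X ^ 2 * derivative ℚ dSeries - (2 : ℚ) • (X ^ 1 * derivative ℚ dSeries)
      + X ^ 0 * derivative ℚ dSeries + (8 : ℚ) • (X ^ 3 * dSeries) - (6 : ℚ) • (X ^ 2 * dSeries)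
      + X ^ 1 * dSeries - X ^ 0 * dSeries by
    simp only [Algebra.smul_def, map_ofNat]; ring] at h
  simp only [map_add, map_sub, coeff_smul, coeff_X_pow_mul_derivative_dSeries,
    coeff_X_pow_mul_dSeries, ← hs, map_zero, smul_eq_mul] at h
  have h0 : dShift 0 (n + 1) = d (n + 1) := by simp [dShift]
  simp only [h0] at h
  push_cast at h
  linear_combination h

theorem d_recurrence {n : ℕ} (hn : 4 ≤ n) :
    (-8 / (n : ℚ) + 4) * d (n - 4) - (-6 / (n : ℚ) + 4) * d (n - 3)
      + (-1 / (n : ℚ) + 1) * d (n - 2) - (-1 / (n : ℚ) + 2) * d (n - 1) + d n = 0 := by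
  obtain ⟨m, rfl⟩ : ∃ m, n = m + 1 := ⟨n - 1, by omega⟩
  have h := d_succ_recurrence m
  simp only [dShift, hn, if_true, show 3 ≤ m + 1 by omega, show 2 ≤ m + 1 by omega,
    show 1 ≤ m + 1 by omega] at h
  generalize d (m + 1 - 4) = a, d (m + 1 - 3) = b, d (m + 1 - 2) = c, d (m + 1 - 1) = x at h ⊢
  have h0 : ((m + 1 : ℕ) : ℚ) ≠ 0 := by positivity
  field_simp
  push_cast
  linear_combination h

theorem delta_recurrence {n : ℕ} (hn : 4 ≤ n) :
    delta n = 1 / ((n : ℚ) * 2 ^ n)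
        + (1 / (2 * (n : ℚ)) - 1 / 4) * delta (n - 4)
        + (-3 / (4 * (n : ℚ)) + 1 / 2) * delta (n - 3)
        + (1 / (4 * (n : ℚ)) - 1 / 4) * delta (n - 2)
        + (-1 / (2 * (n : ℚ)) + 1) * delta (n - 1) := by
  have h := d_recurrence hn
  obtain ⟨m, rfl⟩ : ∃ m, n = m + 4 := ⟨n - 4, by omega⟩
  simp only [show m + 4 - 4 = m by omega, show m + 4 - 3 = m + 1 by omega,
    show m + 4 - 2 = m + 2 by omega, show m + 4 - 1 = m + 3 by omega, d, pow_add] at h ⊢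
  have h0 : ((m + 4 : ℕ) : ℚ) ≠ 0 := by positivity
  have h2 : (2 : ℚ) ^ m ≠ 0 := by positivity
  field_simp at h ⊢
  linear_combination 2 * h

end

/-! ### Convergence and the equation for real `t` -/

theorem norm_d_le (n : ℕ) : ‖(d n : ℝ)‖ ≤ 2 * 2 ^ n := by
  rw [Real.norm_eq_abs]
  exact_mod_cast abs_d_le n

theorem summable_d_mul_pow {t : ℝ} (ht : |t| < 1 / 2) :
    Summable fun n : ℕ => (d n : ℝ) * t ^ n := by
  refine Summable.of_norm_bounded (g := fun n => 2 * (2 * |t|) ^ n)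
    ((summable_geometric_of_lt_one (by positivity) (by linarith)).mul_left 2) fun n => ?_
  rw [norm_mul, norm_pow, mul_pow, ← mul_assoc, Real.norm_eq_abs t]
  gcongr
  exact norm_d_le n

theorem hasDerivAt_tsum_mul_pow {a : ℕ → ℝ} (ha : ∀ n, ‖a n‖ ≤ 2 * 2 ^ n)
    (hsum : ∀ t : ℝ, |t| < 1 / 2 → Summable fun n : ℕ => a n * t ^ n)
    {t : ℝ} (ht : |t| < 1 / 2) :
    Summable (fun n : ℕ => ((n + 1 : ℕ) : ℝ) * a (n + 1) * t ^ n) ∧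
      HasDerivAt (fun t => ∑' n : ℕ, a n * t ^ n)
        (∑' n : ℕ, ((n + 1 : ℕ) : ℝ) * a (n + 1) * t ^ n) t := by
  -- On the ball of radius `r` the derived terms have a common summable majorant, because `2 * r <
  -- 1`.
  obtain ⟨r, hr, hr2⟩ := exists_between ht
  have hr0 : 0 < r := (abs_nonneg t).trans_lt hr
  have hr1 : ‖2 * r‖ < 1 := by
    rw [Real.norm_eq_abs, abs_of_pos (by positivity)]
    linarith
  have hu : Summable fun n : ℕ => 2 / r * ((n : ℝ) ^ 1 * (2 * r) ^ n) :=
    (summable_pow_mul_geometric_of_norm_lt_one 1 hr1).mul_left (2 / r)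
  have hb : ∀ (n : ℕ) (y : ℝ), y ∈ Metric.ball (0 : ℝ) r →
      ‖a n * (n * y ^ (n - 1))‖ ≤ 2 / r * ((n : ℝ) ^ 1 * (2 * r) ^ n) := by
    intro n y hy
    rw [mem_ball_zero_iff] at hy
    rcases n with _ | n
    · simp
    · rw [norm_mul, norm_mul, norm_pow, Real.norm_natCast, Nat.add_sub_cancel]
      calc ‖a (n + 1)‖ * (((n + 1 : ℕ) : ℝ) * ‖y‖ ^ n)
          ≤ (2 * 2 ^ (n + 1)) * (((n + 1 : ℕ) : ℝ) * r ^ n) := by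
            gcongr
            exact ha _
        _ = _ := by field_simp; ring
  have htm : t ∈ Metric.ball (0 : ℝ) r := by simpa using hr
  have hs : Summable fun n : ℕ => a n * (n * t ^ (n - 1)) :=
    Summable.of_norm_bounded hu fun n => hb n t htm
  have hshift : ∀ n : ℕ, a (n + 1) * ((n + 1 : ℕ) * t ^ (n + 1 - 1)) =
      ((n + 1 : ℕ) : ℝ) * a (n + 1) * t ^ n := fun n => by
    rw [Nat.add_sub_cancel]; ring
  refine ⟨((summable_nat_add_iff 1).2 hs).congr fun n => hshift n, ?_⟩
  have h := hasDerivAt_tsum_of_isPreconnected hu Metric.isOpen_ball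
    (convex_ball (0 : ℝ) r).isPreconnected
    (fun n y _ => (hasDerivAt_pow n y).const_mul (a n)) hb htm
    (hsum t ht) htm
  rw [hs.tsum_eq_zero_add, tsum_congr hshift] at h
  simpa using h

theorem hasDerivAt_dFun {t : ℝ} (ht : |t| < 1 / 2) :
    Summable (fun n : ℕ => ((n + 1 : ℕ) : ℝ) * d (n + 1) * t ^ n) ∧
      HasDerivAt dFun (∑' n : ℕ, ((n + 1 : ℕ) : ℝ) * d (n + 1) * t ^ n) t :=
  hasDerivAt_tsum_mul_pow (a := fun n => d n) norm_d_le (fun _ => summable_d_mul_pow) ht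

/-- The power series `φ` converges to `a` at the real number `t`. -/
def SumsTo (φ : PowerSeries ℚ) (t a : ℝ) : Prop :=
  HasSum (fun n : ℕ => ((PowerSeries.coeff n φ : ℚ) : ℝ) * t ^ n) a

namespace SumsTo

variable {φ ψ : PowerSeries ℚ} {t a b : ℝ}

theorem add (h : SumsTo φ t a) (h' : SumsTo ψ t b) : SumsTo (φ + ψ) t (a + b) := by
  refine (HasSum.add h h').congr_fun fun n => ?_
  simp [add_mul]

theorem C_mul (q : ℚ) (h : SumsTo φ t a) : SumsTo (PowerSeries.C q * φ) t (q * a) := by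
  refine (HasSum.mul_left (q : ℝ) h).congr_fun fun n => ?_
  simp [mul_assoc]

theorem X_mul (h : SumsTo φ t a) : SumsTo (PowerSeries.X * φ) t (t * a) := by
  refine (hasSum_nat_add_iff' 1).1 ?_
  simp only [PowerSeries.coeff_succ_X_mul, Finset.range_one, Finset.sum_singleton,
    PowerSeries.coeff_zero_X_mul, Rat.cast_zero, zero_mul, sub_zero]
  refine (HasSum.mul_left t h).congr_fun fun n => ?_
  ring

theorem X_pow_mul (h : SumsTo φ t a) (k : ℕ) : SumsTo (PowerSeries.X ^ k * φ) t (t ^ k * a) := by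
  induction k with
  | zero => simpa using h
  | succ k ih => simpa only [pow_succ', mul_assoc] using ih.X_mul

/-- Multiplication by a polynomial. -/
theorem polynomial_mul (h : SumsTo φ t a) (p : Polynomial ℚ) :
    SumsTo ((p : PowerSeries ℚ) * φ) t (Polynomial.aeval t p * a) := by
  induction p using Polynomial.induction_on' with
  | add p q hp hq => simpa only [Polynomial.coe_add, map_add, add_mul] using hp.add hq
  | monomial k q =>
    have := (h.X_pow_mul k).C_mul q
    rw [← Polynomial.C_mul_X_pow_eq_monomial]
    simpa [mul_assoc] using this

end SumsTo

theorem dFun_differential_equation {t : ℝ} (ht : |t| < 1 / 2) :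
    (4 * t ^ 4 - 4 * t ^ 3 + t ^ 2 - 2 * t + 1) * deriv dFun t
      + (8 * t ^ 3 - 6 * t ^ 2 + t - 1) * dFun t = 0 := by
  obtain ⟨hs, hd⟩ := hasDerivAt_dFun ht
  have h0 : SumsTo dSeries t (dFun t) := by
    simpa [SumsTo, dSeries, dFun] using (summable_d_mul_pow ht).hasSum
  have h1 : SumsTo (PowerSeries.derivative ℚ dSeries) t (deriv dFun t) := by
    rw [hd.deriv]
    refine hs.hasSum.congr_fun fun n => ?_
    rw [PowerSeries.coeff_derivative, dSeries, PowerSeries.coeff_mk]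
    push_cast
    ring
  have h := (h1.polynomial_mul (4 * .X ^ 4 - 4 * .X ^ 3 + .X ^ 2 - 2 * .X + 1)).add
    (h0.polynomial_mul (8 * .X ^ 3 - 6 * .X ^ 2 + .X - 1))
  have hc : ∀ m : ℕ, [m.AtLeastTwo] →
      (((OfNat.ofNat m : Polynomial ℚ)) : PowerSeries ℚ) = OfNat.ofNat m := fun m _ =>
    map_ofNat (Polynomial.coeToPowerSeries.ringHom (R := ℚ)) m
  simp only [Polynomial.coe_add, Polynomial.coe_sub, Polynomial.coe_mul, Polynomial.coe_pow,
    Polynomial.coe_X, Polynomial.coe_one, hc, dSeries_differential_equation, map_add, map_sub,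
    map_mul, map_pow, Polynomial.aeval_X, map_ofNat, map_one] at h
  refine h.unique ?_
  simp

/-! ### The linear-time program -/

theorem Reaches.trans {P : List Instr} {s t : ℕ} {a b c : Config} (h : Reaches P s a b)
    (h' : Reaches P t b c) : Reaches P (s + t) a c := by
  induction s generalizing a with
  | zero =>
    obtain rfl : a = b := h
    simpa using h'
  | succ s ih =>
    obtain ⟨a', ha, hr⟩ := h
    rw [Nat.succ_add]
    exact ⟨a', ha, ih hr⟩

/-- Computes `Δ_1, …, Δ_n` by the recurrence. Register `0` counts the remaining rounds, `1` the
finished ones, registers `2` to `5` hold the last four terms of `d` (extended by `0` to negative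
indices), `6` the power of `2`, `7` and `8` the constants `1` and `1 / 2`, `9` and `10` the
constants `2` and `4`; the others are temporary. -/
def deltaProgram : List Instr :=
  [ .const 7 1, .const 9 2, .const 10 4, .div 8 7 9, .const 6 1, .div 2 7 9,
    .add 1 1 7,
    .mul 6 6 9,
    .sub 11 4 5,
    .mul 12 10 11,
    .add 13 2 2,
    .sub 14 13 3,
    .add 15 14 12,
    .sub 16 3 2,
    .add 17 12 12,
    .sub 18 16 17,
    .add 19 4 4,
    .add 20 18 19,
    .div 21 20 1,
    .add 22 15 21,
    .sub 5 4 23,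
    .sub 4 3 23,
    .sub 3 2 23,
    .sub 2 22 23,
    .sub 24 2 8,
    .div 25 24 6,
    .write 25,
    .sub 0 0 7,
    .jumpPos 0 6,
    .halt ]

/-- The state after `i` rounds on input `n`, up to the line. -/
structure RoundState (n i : ℕ) (c : Config) : Prop where
  remaining : c.reg 0 = (n : ℚ) - i
  index : c.reg 1 = i
  d_one : c.reg 2 = d i
  d_two : c.reg 3 = dShift 1 i
  d_three : c.reg 4 = dShift 2 i
  d_four : c.reg 5 = dShift 3 i
  power : c.reg 6 = 2 ^ i
  one : c.reg 7 = 1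
  half : c.reg 8 = 1 / 2
  two : c.reg 9 = 2
  four : c.reg 10 = 4
  zero : c.reg 23 = 0
  out : c.out = (List.range i).map fun j => delta (j + 1)

theorem step_div {P : List Instr} {c : Config} {r a b : ℕ}
    (h : P[c.line]? = some (.div r a b)) (hb : c.reg b ≠ 0) :
    step P c = some (c.set r (c.reg a / c.reg b)) := by
  simp [step, h, hb]

theorem d_zero : d 0 = 1 / 2 := by
  have h := two_pow_mul_delta 0
  simp only [signTally, Int.sign_zero, Int.cast_zero] at h
  rw [d, h, zero_add]

theorem reaches_loop (n : ℕ) :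
    ∃ c, Reaches deltaProgram 6 (start n) c ∧ c.line = 6 ∧ RoundState n 0 c := by
  refine ⟨_, ⟨_, rfl, _, rfl, _, rfl, _, step_div rfl (by simp [start, Config.set]),
    _, rfl, _, step_div rfl (by simp [Config.set]), rfl⟩, rfl, ?_⟩
  constructor <;> simp [Config.set, start, d_zero, dShift]

theorem reaches_round {n i : ℕ} {c : Config} (hl : c.line = 6) (h : RoundState n i c) :
    ∃ c', Reaches deltaProgram 23 c c' ∧ c'.line = (if (0 : ℚ) < n - (i + 1 : ℕ) then 6 else 29) ∧
      RoundState n (i + 1) c' := by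
  obtain ⟨l, reg, out⟩ := c
  obtain rfl : l = 6 := hl
  have hi : (i : ℚ) + 1 ≠ 0 := by positivity
  obtain ⟨h1, h2, h3, h4, h5, h6, h7, h8, h9, h10, h11, h12, h13⟩ := h
  dsimp only at h1 h2 h3 h4 h5 h6 h7 h8 h9 h10 h11 h12 h13
  -- All steps evaluate by `rfl` except the divisions, by `i + 1` and by `2 ^ (i + 1)`.
  refine ⟨_, ⟨_, rfl, _, rfl, _, rfl, _, rfl, _, rfl, _, rfl, _, rfl, _, rfl, _, rfl, _, rfl,
    _, rfl, _, rfl, _, step_div rfl ?_, _, rfl, _, rfl, _, rfl, _, rfl, _, rfl, _, rfl,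
    _, step_div rfl ?_, _, rfl, _, rfl, _, rfl, rfl⟩, ?_, ?_⟩
  · simp [Config.set, h2, h8, hi]
  · simp [Config.set, h7, h10]
  · simp [Config.set, h1, h8, lt_sub_iff_add_lt']
  · have hshift : ∀ j, dShift (j + 1) (i + 1) = dShift j i := by simp [dShift]
    have h0 : dShift 0 i = d i := by simp [dShift]
    have hd := d_succ_recurrence i
    have hdelta : delta (i + 1) = (d (i + 1) - 1 / 2) / 2 ^ (i + 1) := by
      rw [d, add_sub_cancel_right, mul_div_cancel_left₀ _ (by positivity)]
    rw [hshift 0, hshift 1, hshift 2, hshift 3, h0] at hd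
    -- The left side is the value in register `22`, in the order in which the program builds it.
    have hd' : d i + d i - dShift 1 i + 4 * (dShift 2 i - dShift 3 i) +
        (dShift 1 i - d i - (4 * (dShift 2 i - dShift 3 i) + 4 * (dShift 2 i - dShift 3 i)) +
          (dShift 2 i + dShift 2 i)) / (i + 1) = d (i + 1) := by
      field_simp
      linear_combination -hd
    constructor
    all_goals simp [Config.set, h1, h2, h3, h4, h5, h6, h7, h8, h9, h10, h11, h12, h13]
    · ring
    · exact hd'
    · rw [hshift 0, h0]
    · exact (hshift 1).symm
    · exact (hshift 2).symm
    · exact (pow_succ 2 i).symm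
    · rw [hd', List.range_succ, List.map_append, List.map_singleton, hdelta, pow_succ, one_div]

theorem reaches_rounds {n i : ℕ} (hi : i < n) :
    ∃ c, Reaches deltaProgram (6 + 23 * i) (start n) c ∧ c.line = 6 ∧ RoundState n i c := by
  induction i with
  | zero => exact reaches_loop n
  | succ i ih =>
    obtain ⟨c, hr, hl, hc⟩ := ih (by omega)
    obtain ⟨c', hr', hl', hc'⟩ := reaches_round hl hc
    refine ⟨c', hr.trans hr', ?_, hc'⟩
    rw [hl', if_pos (sub_pos.2 (by exact_mod_cast hi))]

theorem deltaProgram_outputs {n : ℕ} (hn : 1 ≤ n) :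
    OutputsInTime deltaProgram n ((List.range n).map fun i => delta (i + 1)) (6 + 23 * n) := by
  obtain ⟨m, rfl⟩ : ∃ m, n = m + 1 := ⟨n - 1, by omega⟩
  obtain ⟨c, hr, hl, hc⟩ := reaches_rounds (Nat.lt_succ_self m)
  obtain ⟨c', hr', hl', hc'⟩ := reaches_round hl hc
  rw [sub_self, if_neg (lt_irrefl _)] at hl'
  exact ⟨c', hr.trans hr', by rw [hl']; rfl, hc'.out⟩

end CoinGame

theorem mainTheorem5 :
    -- the differential equation, for the formal power series
    ((4 * PowerSeries.X ^ 4 - 4 * PowerSeries.X ^ 3 + PowerSeries.X ^ 2 - 2 * PowerSeries.X + 1)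
          * PowerSeries.derivative ℚ CoinGame.dSeries
        + (8 * PowerSeries.X ^ 3 - 6 * PowerSeries.X ^ 2 + PowerSeries.X - 1)
          * CoinGame.dSeries = 0) ∧
    -- the differential equation, for the function on the interval `|t| < 1 / 2`
    (∀ t : ℝ, |t| < 1 / 2 →
      Summable (fun n : ℕ => (CoinGame.d n : ℝ) * t ^ n) ∧
      DifferentiableAt ℝ CoinGame.dFun t ∧
      (4 * t ^ 4 - 4 * t ^ 3 + t ^ 2 - 2 * t + 1) * deriv CoinGame.dFun t
        + (8 * t ^ 3 - 6 * t ^ 2 + t - 1) * CoinGame.dFun t = 0) ∧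
    -- the recurrence for `d_n`
    (∀ n : ℕ, 4 ≤ n →
      (-8 / (n : ℚ) + 4) * CoinGame.d (n - 4) - (-6 / (n : ℚ) + 4) * CoinGame.d (n - 3)
        + (-1 / (n : ℚ) + 1) * CoinGame.d (n - 2) - (-1 / (n : ℚ) + 2) * CoinGame.d (n - 1)
        + CoinGame.d n = 0) ∧
    -- the recurrence for `Δ_n`
    (∀ n : ℕ, 4 ≤ n →
      CoinGame.delta n = 1 / ((n : ℚ) * 2 ^ n)
        + (1 / (2 * (n : ℚ)) - 1 / 4) * CoinGame.delta (n - 4)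
        + (-3 / (4 * (n : ℚ)) + 1 / 2) * CoinGame.delta (n - 3)
        + (1 / (4 * (n : ℚ)) - 1 / 4) * CoinGame.delta (n - 2)
        + (-1 / (2 * (n : ℚ)) + 1) * CoinGame.delta (n - 1)) ∧
    -- one program computes `Δ_1, …, Δ_n` from `n` in time `O(n)`
    (∃ (P : List CoinGame.Instr) (C : ℕ), ∀ n : ℕ, 1 ≤ n → ∃ t : ℕ, t ≤ C * n ∧
      CoinGame.OutputsInTime P n ((List.range n).map fun i => CoinGame.delta (i + 1)) t) := by
  refine ⟨CoinGame.dSeries_differential_equation, fun t ht => ⟨CoinGame.summable_d_mul_pow ht,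
      (CoinGame.hasDerivAt_dFun ht).2.differentiableAt, CoinGame.dFun_differential_equation ht⟩,
    fun n => CoinGame.d_recurrence, fun n => CoinGame.delta_recurrence,
    -- `6 + 23 * n ≤ 29 * n` because `1 ≤ n`.
    CoinGame.deltaProgram, 29, fun n hn =>
      ⟨6 + 23 * n, by omega, CoinGame.deltaProgram_outputs hn⟩⟩
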